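/- Let $m,n$ be integers with $0<m<n$, and let $G(n,m)$ be the Grassmannian of $m$-dimensional linear subspaces of $\mathbb{R}^n$, equipped with the metric $d_\pi(V,W)=\|\pi_V-\pi_W\|$, where $\pi_V:\mathbb{R}^n\to V\subset\mathbb{R}^n$ denotes the orthogonal projection onto $V$ and $\|\cdot\|$ is the operator norm with respect to the Euclidean norm. Let $\gamma_{n,m}$ be the natural $O(n)$-invariant Borel probability measure on $G(n,m)$, i.e. the image of the Haar probability measure of the orthogonal group $O(n)$ under the map $g\mapsto gV_0$, where $V_0=\mathbb{R}^m\times\{0\}$. Then there exist constants $0<c<C<\infty$ and $\delta_0>0$ (depending only on $n$ and $m$) such that $$c\,\delta^{m(n-m)}\le\gamma_{n,m}(B(V,\delta))\le C\,\delta^{m(n-m)}$$ for all $V\in G(n,m)$ and all $0<\delta<\delta_0$, where $B(V,\delta)=\{W\in G(n,m):d_\pi(V,W)\le\delta\}$ is the closed ball. -/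

import Mathlib

open MeasureTheory

noncomputable section

/-- Euclidean space `ℝⁿ`. -/
abbrev Eucl (n : ℕ) : Type := EuclideanSpace ℝ (Fin n)

/-- The Grassmannian `G(n,m)` of `m`-dimensional linear subspaces of `ℝⁿ`. -/
@[ext]
structure Grass (n m : ℕ) : Type where
  toSubmodule : Submodule ℝ (Eucl n)
  finrank_eq : Module.finrank ℝ toSubmodule = m

namespace Grass

/-- The orthogonal projection `π_V` onto `V`, as a bounded operator `ℝⁿ → ℝⁿ`. -/
def proj {n m : ℕ} (V : Grass n m) : Eucl n →L[ℝ] Eucl n :=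
  V.toSubmodule.starProjection

theorem proj_injective (n m : ℕ) :
    Function.Injective (proj : Grass n m → Eucl n →L[ℝ] Eucl n) := by
  intro V W h
  exact Grass.ext (Submodule.starProjection_inj.mp h)

/-- The projection metric `d_π(V,W) = ‖π_V - π_W‖` (operator norm); see `Grass.dist_eq`. -/
instance (n m : ℕ) : MetricSpace (Grass n m) :=
  MetricSpace.induced proj (proj_injective n m) inferInstance

theorem dist_eq {n m : ℕ} (V W : Grass n m) : dist V W = ‖V.proj - W.proj‖ :=
  dist_eq_norm V.proj W.proj

instance (n m : ℕ) : MeasurableSpace (Grass n m) := borel _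

instance (n m : ℕ) : BorelSpace (Grass n m) := ⟨rfl⟩

/-- The orthogonal group `O(n)`: the linear operators `g` on `ℝⁿ` with
`g* g = g g* = 1`, with the topology given by the operator norm. -/
abbrev O (n : ℕ) : Type := unitary (Eucl n →L[ℝ] Eucl n)

instance (n : ℕ) : ContinuousStar (Eucl n →L[ℝ] Eucl n) :=
  ⟨(ContinuousLinearMap.adjoint (𝕜 := ℝ) (E := Eucl n) (F := Eucl n)).continuous⟩

instance (n : ℕ) : CompactSpace (O n) := by
  suffices h : IsCompact (unitary (Eucl n →L[ℝ] Eucl n) : Set (Eucl n →L[ℝ] Eucl n)) from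
    isCompact_iff_compactSpace.mp h
  refine Metric.isCompact_of_isClosed_isBounded isClosed_unitary ?_
  refine (Metric.isBounded_closedBall (x := (0 : Eucl n →L[ℝ] Eucl n)) (r := 1)).subset ?_
  intro g hg
  rw [mem_closedBall_zero_iff]
  refine ContinuousLinearMap.opNorm_le_bound _ zero_le_one fun x => ?_
  rw [one_mul]
  exact (Unitary.norm_map (⟨g, hg⟩ : O n) x).le

/-- The image `g V` of the plane `V` under `g ∈ O(n)`. -/
def rotate {n m : ℕ} (g : O n) (V : Grass n m) : Grass n m where
  toSubmodule := V.toSubmodule.map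
    ((Unitary.linearIsometryEquiv g).toLinearEquiv : Eucl n →ₗ[ℝ] Eucl n)
  finrank_eq := (LinearEquiv.finrank_map_eq _ _).trans V.finrank_eq

theorem proj_rotate {n m : ℕ} (g : O n) (V : Grass n m) :
    (rotate g V).proj = (g : Eucl n →L[ℝ] Eucl n) * V.proj * star (g : Eucl n →L[ℝ] Eucl n) := by
  ext1 x
  exact Submodule.starProjection_map_apply (Unitary.linearIsometryEquiv g) V.toSubmodule x

theorem continuous_rotate {n m : ℕ} (V : Grass n m) :
    Continuous fun g : O n => rotate g V := by
  refine continuous_induced_rng.mpr ?_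
  have h : (proj ∘ fun g : O n => rotate g V) = fun g : O n =>
      (g : Eucl n →L[ℝ] Eucl n) * V.proj * star (g : Eucl n →L[ℝ] Eucl n) :=
    funext fun g => proj_rotate g V
  rw [h]
  exact (continuous_subtype_val.mul continuous_const).mul continuous_subtype_val.star

/-- The base plane `ℝᵐ × {0}`, spanned by the first `m` standard basis vectors of `ℝⁿ`. -/
def base {n m : ℕ} (h : m ≤ n) : Grass n m where
  toSubmodule := Submodule.span ℝ
    (Set.range fun i : Fin m => (EuclideanSpace.single (Fin.castLE h i) 1 : Eucl n))
  finrank_eq := by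
    have hli : LinearIndependent ℝ
        (fun i : Fin m => (EuclideanSpace.single (Fin.castLE h i) 1 : Eucl n)) :=
      ((EuclideanSpace.orthonormal_single (𝕜 := ℝ) (ι := Fin n)).comp _
        (Fin.castLE_injective h)).linearIndependent
    rw [finrank_span_eq_card hli, Fintype.card_fin]

/-- The natural `O(n)`-invariant probability measure `γ_{n,m}` on `G(n,m)`: the image of the Haar
probability measure of `O(n)` under the orbit map `g ↦ g V₀`, where `V₀ = ℝᵐ × {0}`. -/
def gamma {n m : ℕ} (h : m ≤ n) : Measure (Grass n m) :=
  (Measure.haarMeasure (⊤ : TopologicalSpace.PositiveCompacts (O n))).map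
    fun g => rotate g (base h)

instance {n m : ℕ} (h : m ≤ n) : IsProbabilityMeasure (gamma h) := by
  have : IsProbabilityMeasure
      (Measure.haarMeasure (⊤ : TopologicalSpace.PositiveCompacts (O n))) :=
    ⟨Measure.haarMeasure_self⟩
  exact Measure.isProbabilityMeasure_map (continuous_rotate (base h)).measurable.aemeasurable

end Grass

end

/-! `O(n)` acts transitively by isometries and preserves `gamma`, so all balls of radius δ have one
common measure (`gamma_closedBall_eq`). The map Φ sending A to its graph carries Hom(V, Vᗮ), a space
of dimension m(n-m), into the Grassmannian. It is Lipschitz (`dist_graph_le`), inverse Lipschitz on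
the unit ball (`norm_sub_le_dist_graph`), and covers a ball about V (`exists_graph_eq`).

No density of `gamma` in this chart is needed. Fubini for the pairs (A, y) with ‖A‖ ≤ 1 and dist(Φ
A, y) ≤ δ expresses the common measure as an average over y of Haar measures of slices. Each slice
lies in a ball of radius comparable to δ, and contains one when y is near V. -/

namespace Grass

variable {n m : ℕ}

/-! ### Orthogonal projections and the gap between planes -/

theorem norm_proj_sub_proj_apply_le (V W : Grass n m) (x : Eucl n) :
    ‖V.proj x - W.proj x‖ ≤ dist V W * ‖x‖ := by
  rw [dist_eq]
  exact (V.proj - W.proj).le_opNorm x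

theorem proj_apply_mem (V : Grass n m) (x : Eucl n) : V.proj x ∈ V.toSubmodule :=
  Submodule.starProjection_apply_mem _ x

theorem proj_eq_self (V : Grass n m) {x : Eucl n} (hx : x ∈ V.toSubmodule) : V.proj x = x :=
  Submodule.starProjection_eq_self_iff.mpr hx

theorem proj_eq_zero (V : Grass n m) {x : Eucl n} (hx : x ∈ V.toSubmoduleᗮ) : V.proj x = 0 :=
  (Submodule.starProjection_apply_eq_zero_iff _).mpr hx

theorem norm_proj_apply_le (V : Grass n m) (x : Eucl n) : ‖V.proj x‖ ≤ ‖x‖ :=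
  Submodule.norm_starProjection_apply_le _ x

theorem sub_proj_apply (V : Grass n m) (x : Eucl n) :
    x - V.proj x = V.toSubmoduleᗮ.starProjection x := by
  rw [Submodule.starProjection_orthogonal_val]
  rfl

theorem norm_sub_proj_apply_le (V : Grass n m) (x : Eucl n) : ‖x - V.proj x‖ ≤ ‖x‖ := by
  rw [sub_proj_apply]
  exact Submodule.norm_starProjection_apply_le _ x

theorem norm_sub_proj_apply_le_norm_sub (W : Grass n m) (v : Eucl n) {w : Eucl n}
    (hw : w ∈ W.toSubmodule) : ‖v - W.proj v‖ ≤ ‖v - w‖ := by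
  have h := W.norm_sub_proj_apply_le (v - w)
  rwa [map_sub, W.proj_eq_self hw, sub_sub_sub_cancel_right] at h

theorem star_proj (V : Grass n m) : star V.proj = V.proj :=
  isSelfAdjoint_starProjection V.toSubmodule

theorem star_one_sub_proj (V : Grass n m) : star (1 - V.proj) = 1 - V.proj :=
  (IsSelfAdjoint.one _).sub (isSelfAdjoint_starProjection V.toSubmodule)

/-- One-sided gap: the operator `(1 - π_W) π_V` is small if every vector of `V` is close to `W`. -/
theorem norm_one_sub_proj_mul_proj_le {V W : Grass n m} {a : ℝ} (ha : 0 ≤ a)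
    (h : ∀ v ∈ V.toSubmodule, ∃ w ∈ W.toSubmodule, ‖v - w‖ ≤ a * ‖v‖) :
    ‖(1 - W.proj) * V.proj‖ ≤ a := by
  refine ContinuousLinearMap.opNorm_le_bound _ ha fun x => ?_
  obtain ⟨w, hw, hle⟩ := h _ (V.proj_apply_mem x)
  calc ‖V.proj x - W.proj (V.proj x)‖ ≤ ‖V.proj x - w‖ := W.norm_sub_proj_apply_le_norm_sub _ hw
    _ ≤ a * ‖V.proj x‖ := hle
    _ ≤ a * ‖x‖ := by gcongr; exact V.norm_proj_apply_le x

/-- The difference π_V - π_W equals (1 - π_W)π_V - π_W(1 - π_V), and the last product is the adjoint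
of (1 - π_V)π_W. Each one-sided gap thus bounds one term. -/
theorem dist_le_of_gap {V W : Grass n m} {a : ℝ} (ha : 0 ≤ a)
    (hVW : ∀ v ∈ V.toSubmodule, ∃ w ∈ W.toSubmodule, ‖v - w‖ ≤ a * ‖v‖)
    (hWV : ∀ w ∈ W.toSubmodule, ∃ v ∈ V.toSubmodule, ‖w - v‖ ≤ a * ‖w‖) :
    dist V W ≤ 2 * a := by
  have h₁ := norm_one_sub_proj_mul_proj_le ha hVW
  have h₂ := norm_one_sub_proj_mul_proj_le ha hWV
  rw [← norm_star, star_mul, star_proj, star_one_sub_proj] at h₂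
  have h : V.proj - W.proj = (1 - W.proj) * V.proj - W.proj * (1 - V.proj) := by
    rw [sub_mul, mul_sub, one_mul, mul_one]
    abel
  rw [dist_eq, h]
  linarith [norm_sub_le ((1 - W.proj) * V.proj) (W.proj * (1 - V.proj))]

/-! ### The graph chart -/

/-- The linear map `u ↦ u + A u`, which parametrizes the graph of `A : V → Vᗮ`. -/
noncomputable def graphMap (V : Grass n m) (A : V.toSubmodule →L[ℝ] V.toSubmoduleᗮ) :
    V.toSubmodule →ₗ[ℝ] Eucl n :=
  V.toSubmodule.subtype + V.toSubmoduleᗮ.subtype ∘ₗ (A : V.toSubmodule →ₗ[ℝ] V.toSubmoduleᗮ)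

theorem graphMap_apply (V : Grass n m) (A : V.toSubmodule →L[ℝ] V.toSubmoduleᗮ)
    (u : V.toSubmodule) : V.graphMap A u = u + A u := rfl

theorem proj_graphMap (V : Grass n m) (A : V.toSubmodule →L[ℝ] V.toSubmoduleᗮ)
    (u : V.toSubmodule) : V.proj (V.graphMap A u) = u := by
  rw [graphMap_apply, map_add, V.proj_eq_self u.2, V.proj_eq_zero (A u).2, add_zero]

theorem graphMap_injective (V : Grass n m) (A : V.toSubmodule →L[ℝ] V.toSubmoduleᗮ) :
    Function.Injective (V.graphMap A) := fun u v h => by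
  rw [← Subtype.coe_inj, ← V.proj_graphMap A u, h, V.proj_graphMap]

theorem norm_le_norm_graphMap (V : Grass n m) (A : V.toSubmodule →L[ℝ] V.toSubmoduleᗮ)
    (u : V.toSubmodule) : ‖u‖ ≤ ‖V.graphMap A u‖ := by
  have h := V.norm_proj_apply_le (V.graphMap A u)
  rwa [proj_graphMap] at h

theorem norm_graphMap_le (V : Grass n m) (A : V.toSubmodule →L[ℝ] V.toSubmoduleᗮ)
    (u : V.toSubmodule) : ‖V.graphMap A u‖ ≤ (1 + ‖A‖) * ‖u‖ := by
  rw [graphMap_apply, add_mul, one_mul]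
  exact (norm_add_le _ _).trans (add_le_add le_rfl (A.le_opNorm u))

/-- The graph of `A : V → Vᗮ`, as an `m`-plane. -/
noncomputable def graph (V : Grass n m) (A : V.toSubmodule →L[ℝ] V.toSubmoduleᗮ) : Grass n m where
  toSubmodule := LinearMap.range (V.graphMap A)
  finrank_eq := (LinearMap.finrank_range_of_inj (V.graphMap_injective A)).trans V.finrank_eq

theorem graphMap_mem_graph (V : Grass n m) (A : V.toSubmodule →L[ℝ] V.toSubmoduleᗮ)
    (u : V.toSubmodule) : V.graphMap A u ∈ (V.graph A).toSubmodule :=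
  LinearMap.mem_range_self _ u

theorem exists_mem_graph_norm_sub_le (V : Grass n m)
    (A B : V.toSubmodule →L[ℝ] V.toSubmoduleᗮ) :
    ∀ v ∈ (V.graph A).toSubmodule, ∃ w ∈ (V.graph B).toSubmodule, ‖v - w‖ ≤ ‖A - B‖ * ‖v‖ := by
  rintro _ ⟨u, rfl⟩
  refine ⟨_, V.graphMap_mem_graph B u, ?_⟩
  calc ‖V.graphMap A u - V.graphMap B u‖ = ‖(A - B) u‖ := by
        rw [graphMap_apply, graphMap_apply, add_sub_add_left_eq_sub]
        rfl
    _ ≤ ‖A - B‖ * ‖u‖ := (A - B).le_opNorm u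
    _ ≤ ‖A - B‖ * ‖V.graphMap A u‖ := by gcongr; exact V.norm_le_norm_graphMap A u

theorem dist_graph_le (V : Grass n m) (A B : V.toSubmodule →L[ℝ] V.toSubmoduleᗮ) :
    dist (V.graph A) (V.graph B) ≤ 2 * ‖A - B‖ :=
  dist_le_of_gap (norm_nonneg (A - B)) (V.exists_mem_graph_norm_sub_le A B)
    (norm_sub_rev A B ▸ V.exists_mem_graph_norm_sub_le B A)

theorem continuous_graph (V : Grass n m) : Continuous V.graph :=
  (LipschitzWith.of_dist_le_mul (f := V.graph) (K := 2) fun A B => by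
    rw [dist_eq_norm A B]
    exact V.dist_graph_le A B).continuous

/-- Project v = u + Au onto the graph of B, obtaining u' + Bu'. The V and Vᗮ components of the
difference control u' - u and Au - Bu', hence (A - B)u. -/
theorem norm_sub_le_dist_graph (V : Grass n m) (A B : V.toSubmodule →L[ℝ] V.toSubmoduleᗮ) :
    ‖A - B‖ ≤ (1 + ‖A‖) * (1 + ‖B‖) * dist (V.graph A) (V.graph B) := by
  refine ContinuousLinearMap.opNorm_le_bound _ (by positivity) fun u => ?_
  set d := dist (V.graph A) (V.graph B)
  set v := V.graphMap A u
  obtain ⟨u', hu'⟩ := (V.graph B).proj_apply_mem v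
  have hvw : ‖v - V.graphMap B u'‖ ≤ d * ‖v‖ := by
    have h := (V.graph A).norm_proj_sub_proj_apply_le (V.graph B) v
    rwa [(V.graph A).proj_eq_self (V.graphMap_mem_graph A u), ← hu'] at h
  have h₁ : ‖u' - u‖ ≤ ‖v - V.graphMap B u'‖ := by
    have h := V.norm_proj_apply_le (v - V.graphMap B u')
    rw [map_sub, proj_graphMap, proj_graphMap] at h
    rwa [norm_sub_rev]
  have h₂ : ‖A u - B u'‖ ≤ ‖v - V.graphMap B u'‖ := by
    have h := V.norm_sub_proj_apply_le (v - V.graphMap B u')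
    rw [map_sub, proj_graphMap, proj_graphMap] at h
    have h' : v - V.graphMap B u' - (u - u') = (A u - B u' : V.toSubmoduleᗮ) := by
      rw [Submodule.coe_sub, graphMap_apply]
      simp only [v, graphMap_apply]
      abel
    rwa [h'] at h
  have h₃ : (A - B) u = (A u - B u') + B (u' - u) := by
    rw [map_sub, sub_apply]
    abel
  calc ‖(A - B) u‖ ≤ ‖A u - B u'‖ + ‖B (u' - u)‖ := h₃ ▸ norm_add_le _ _
    _ ≤ ‖v - V.graphMap B u'‖ + ‖B‖ * ‖v - V.graphMap B u'‖ :=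
        add_le_add h₂ ((B.le_opNorm _).trans (by gcongr))
    _ = (1 + ‖B‖) * ‖v - V.graphMap B u'‖ := by ring
    _ ≤ (1 + ‖B‖) * (d * ((1 + ‖A‖) * ‖u‖)) := by
        gcongr
        exact hvw.trans (by gcongr; exact V.norm_graphMap_le A u)
    _ = (1 + ‖A‖) * (1 + ‖B‖) * d * ‖u‖ := by ring

/-- Every plane close to `V` is the graph of a small operator `V → Vᗮ`. -/
theorem exists_graph_eq (V W : Grass n m) (h : dist V W ≤ 1 / 3) :
    ∃ A : V.toSubmodule →L[ℝ] V.toSubmoduleᗮ, ‖A‖ ≤ 1 / 2 ∧ V.graph A = W := by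
  have hsub : ∀ w ∈ W.toSubmodule, ‖w - V.proj w‖ ≤ 1 / 3 * ‖w‖ := fun w hw => by
    have h' := V.norm_proj_sub_proj_apply_le W w
    rw [W.proj_eq_self hw, norm_sub_rev] at h'
    exact h'.trans (by gcongr)
  let P : W.toSubmodule →ₗ[ℝ] V.toSubmodule :=
    ((V.proj : Eucl n →ₗ[ℝ] Eucl n).comp W.toSubmodule.subtype).codRestrict V.toSubmodule
      fun w => V.proj_apply_mem w
  have hP : ∀ w, (P w : Eucl n) = V.proj w := fun _ => rfl
  -- A vector w of W killed by π_V satisfies ‖w‖ ≤ ‖w‖/3.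
  have hinj : Function.Injective P := by
    refine (injective_iff_map_eq_zero P).mpr fun w hw => ?_
    have h₁ := hsub w w.2
    rw [← hP, hw, Submodule.coe_zero, sub_zero] at h₁
    rw [← Submodule.coe_eq_zero, ← norm_eq_zero]
    linarith [norm_nonneg (w : Eucl n)]
  let e := LinearEquiv.ofInjectiveOfFinrankEq P hinj (W.finrank_eq.trans V.finrank_eq.symm)
  have he : ∀ u, V.proj (e.symm u : Eucl n) = u := fun u => by
    rw [← hP]
    exact congrArg Subtype.val (e.apply_symm_apply u)
  let A₀ : V.toSubmodule →ₗ[ℝ] V.toSubmoduleᗮ :=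
    (W.toSubmodule.subtype ∘ₗ (e.symm : V.toSubmodule →ₗ[ℝ] W.toSubmodule)
      - V.toSubmodule.subtype).codRestrict V.toSubmoduleᗮ fun u => by
        rw [← Submodule.starProjection_apply_eq_zero_iff]
        change V.proj ((e.symm u : Eucl n) - u) = 0
        rw [map_sub, he, V.proj_eq_self u.2, sub_self]
  let A : V.toSubmodule →L[ℝ] V.toSubmoduleᗮ := LinearMap.toContinuousLinearMap A₀
  have hA : ∀ u, (A u : Eucl n) = e.symm u - u := fun _ => rfl
  clear_value A
  have hgraph : ∀ u, V.graphMap A u = e.symm u := fun u => by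
    rw [graphMap_apply, hA, add_sub_cancel]
  refine ⟨A, ContinuousLinearMap.opNorm_le_bound _ (by norm_num) fun u => ?_, Grass.ext ?_⟩
  · have h₁ := hsub _ (e.symm u).2
    rw [he] at h₁
    have h₂ : ‖A u‖ = ‖(e.symm u : Eucl n) - u‖ := by
      rw [← hA, Submodule.coe_norm]
    -- From ‖Au‖ ≤ ‖u + Au‖/3 ≤ (‖Au‖ + ‖u‖)/3 comes the constant 1/2.
    have h₃ := norm_add_le ((e.symm u : Eucl n) - u) u
    rw [sub_add_cancel] at h₃
    rw [h₂]
    change _ ≤ 1 / 2 * ‖(u : Eucl n)‖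
    linarith
  · ext x
    constructor
    · rintro ⟨u, rfl⟩
      rw [hgraph]
      exact (e.symm u).2
    · exact fun hx => ⟨e ⟨x, hx⟩, by rw [hgraph, e.symm_apply_apply]⟩

/-! ### Invariance and the common measure of balls -/

theorem rotate_mul (g h : O n) (V : Grass n m) : rotate (g * h) V = rotate g (rotate h V) := by
  apply proj_injective
  simp only [proj_rotate, Submonoid.coe_mul, star_mul, mul_assoc]

theorem dist_rotate (g : O n) (V W : Grass n m) : dist (rotate g V) (rotate g W) = dist V W := by
  rw [dist_eq, dist_eq, proj_rotate, proj_rotate, ← sub_mul, ← mul_sub, ← Unitary.coe_star,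
    CStarRing.norm_mul_coe_unitary, CStarRing.norm_coe_unitary_mul]

/-- An isometry of V onto W, matching orthonormal bases, extends to all of ℝⁿ. -/
theorem exists_rotate_eq (V W : Grass n m) : ∃ g : O n, rotate g V = W := by
  let e : V.toSubmodule ≃ₗᵢ[ℝ] W.toSubmodule :=
    (stdOrthonormalBasis ℝ V.toSubmodule).equiv (stdOrthonormalBasis ℝ W.toSubmodule)
      (finCongr (V.finrank_eq.trans W.finrank_eq.symm))
  let L := (W.toSubmodule.subtypeₗᵢ.comp e.toLinearIsometry).extend
  refine ⟨Unitary.linearIsometryEquiv.symm (L.toLinearIsometryEquiv rfl), Grass.ext ?_⟩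
  have hL : ∀ v : V.toSubmodule, L v = e v := LinearIsometry.extend_apply _
  ext x
  simp only [rotate, MulEquiv.apply_symm_apply]
  constructor
  · rintro ⟨v, hv, rfl⟩
    exact hL ⟨v, hv⟩ ▸ (e ⟨v, hv⟩).2
  · intro hx
    refine ⟨e.symm ⟨x, hx⟩, (e.symm ⟨x, hx⟩).2, ?_⟩
    exact (hL _).trans (congrArg Subtype.val (e.apply_symm_apply ⟨x, hx⟩))

theorem gamma_preimage_rotate (h : m ≤ n) (g : O n) {s : Set (Grass n m)} (hs : MeasurableSet s) :
    gamma h (rotate g ⁻¹' s) = gamma h s := by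
  have hg : Continuous (rotate g : Grass n m → Grass n m) :=
    (Isometry.of_dist_eq (dist_rotate g)).continuous
  have hb := (continuous_rotate (base h)).measurable
  rw [gamma, Measure.map_apply hb hs, Measure.map_apply hb (hg.measurable hs),
    ← measure_preimage_mul (Measure.haarMeasure ⊤) g ((fun g => rotate g (base h)) ⁻¹' s)]
  simp only [← Set.preimage_comp, Function.comp_def, rotate_mul]

theorem gamma_closedBall_eq (h : m ≤ n) (V W : Grass n m) (r : ℝ) :
    gamma h (Metric.closedBall V r) = gamma h (Metric.closedBall W r) := by
  obtain ⟨g, rfl⟩ := exists_rotate_eq W V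
  rw [← gamma_preimage_rotate h g (s := Metric.closedBall (rotate g W) r)
    Metric.isClosed_closedBall.measurableSet]
  congr 1
  ext U
  simp only [Set.mem_preimage, Metric.mem_closedBall, dist_rotate]

instance (n m : ℕ) : SecondCountableTopology (Grass n m) :=
  (Topology.IsInducing.mk (rfl : (_ : TopologicalSpace (Grass n m)) = _)
    : Topology.IsInducing (proj : Grass n m → Eucl n →L[ℝ] Eucl n)).secondCountableTopology

/-- If one ball were null, all balls of that radius would be, and second countability would make the
whole space null. -/
theorem gamma_closedBall_pos (h : m ≤ n) (V : Grass n m) {r : ℝ} (hr : 0 < r) :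
    0 < gamma h (Metric.closedBall V r) := by
  refine pos_iff_ne_zero.mpr fun h0 => ?_
  have huniv : gamma h Set.univ = 0 := measure_null_of_locally_null _ fun W _ =>
    ⟨Metric.closedBall W r, mem_nhdsWithin_of_mem_nhds (Metric.closedBall_mem_nhds W hr),
      (gamma_closedBall_eq h W V r).trans h0⟩
  rw [measure_univ] at huniv
  exact one_ne_zero huniv

theorem finrank_hom_orthogonal (V : Grass n m) :
    Module.finrank ℝ (V.toSubmodule →L[ℝ] V.toSubmoduleᗮ) = m * (n - m) := by
  have h := V.toSubmodule.finrank_add_finrank_orthogonal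
  rw [V.finrank_eq, finrank_euclideanSpace_fin] at h
  rw [← (LinearMap.toContinuousLinearMap
    (E := V.toSubmodule) (F' := V.toSubmoduleᗮ) (𝕜 := ℝ)).finrank_eq,
    Module.finrank_linearMap, V.finrank_eq, Nat.eq_sub_of_add_eq' h]

end Grass

/-! ### Uniform ball measures through a bi-Lipschitz chart -/

section UniformBalls

variable {E X : Type*} [NormedAddCommGroup E] [NormedSpace ℝ E] [FiniteDimensional ℝ E]
  [PseudoMetricSpace X] [SecondCountableTopology X] [MeasurableSpace X] [BorelSpace X]
  {γ : Measure X} {Φ : E → X}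

/-- If all `γ`-balls of radius `δ` have the same measure, then the average over `y` of the Haar
measure of the part of the unit ball that `Φ` maps close to `y` is known, by Fubini's theorem. -/
theorem lintegral_measure_preimage_closedBall [MeasurableSpace E] [BorelSpace E] (μ : Measure E)
    [μ.IsAddHaarMeasure] [SFinite γ] (hΦ : Continuous Φ) {δ : ℝ}
    (hγ : ∀ x y, γ (Metric.closedBall x δ) = γ (Metric.closedBall y δ)) (x : X) :
    ∫⁻ y, μ (Metric.closedBall 0 1 ∩ Φ ⁻¹' Metric.closedBall y δ) ∂γ =
      γ (Metric.closedBall x δ) * μ (Metric.ball 0 1) := by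
  have : ProperSpace E := FiniteDimensional.proper ℝ E
  let s : Set (E × X) := {p | dist (Φ p.1) p.2 ≤ δ}
  have hs : MeasurableSet s := (isClosed_le
    ((hΦ.comp continuous_fst).dist continuous_snd) continuous_const).measurableSet
  have h₁ := Measure.prod_apply (μ := μ.restrict (Metric.closedBall 0 1)) (ν := γ) hs
  rw [Measure.prod_apply_symm hs] at h₁
  have h₂ : ∀ A, Prod.mk A ⁻¹' s = Metric.closedBall (Φ A) δ := fun A => by
    ext y
    simp only [s, Set.mem_preimage, Set.mem_ofPred_eq, Metric.mem_closedBall']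
  have h₃ : ∀ y, (fun A => (A, y)) ⁻¹' s = Φ ⁻¹' Metric.closedBall y δ := fun _ => rfl
  simp only [h₂, h₃, hγ _ x, lintegral_const, Measure.restrict_apply_univ] at h₁
  have h₄ : μ (Metric.closedBall 0 1) = μ (Metric.ball 0 1) := by
    rw [Measure.addHaar_closedBall μ 0 zero_le_one, one_pow, ENNReal.ofReal_one, one_mul]
  rw [← h₄, ← h₁]
  refine lintegral_congr fun y => ?_
  rw [Measure.restrict_apply (Metric.isClosed_closedBall.preimage hΦ).measurableSet,
    Set.inter_comm]

theorem measure_closedBall_le_of_antilipschitz [IsProbabilityMeasure γ] (hΦ : Continuous Φ)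
    {δ K : ℝ} (hδ : 0 ≤ δ) (hK : 0 ≤ K)
    (hγ : ∀ x y, γ (Metric.closedBall x δ) = γ (Metric.closedBall y δ))
    (hanti : ∀ A B, ‖A‖ ≤ 1 → ‖B‖ ≤ 1 → ‖A - B‖ ≤ K * dist (Φ A) (Φ B)) (x : X) :
    γ (Metric.closedBall x δ) ≤ ENNReal.ofReal ((K * (2 * δ)) ^ Module.finrank ℝ E) := by
  borelize E
  have : ProperSpace E := FiniteDimensional.proper ℝ E
  let μ : Measure E := Measure.addHaar
  have hM : μ (Metric.ball 0 1) ≠ 0 := (Metric.measure_ball_pos μ 0 one_pos).ne'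
  have hM' : μ (Metric.ball 0 1) ≠ ⊤ := measure_ball_lt_top.ne
  rw [← ENNReal.mul_le_mul_iff_left hM hM', ← lintegral_measure_preimage_closedBall μ hΦ hγ]
  calc ∫⁻ y, μ (Metric.closedBall 0 1 ∩ Φ ⁻¹' Metric.closedBall y δ) ∂γ
      ≤ ∫⁻ _, ENNReal.ofReal ((K * (2 * δ)) ^ Module.finrank ℝ E) * μ (Metric.ball 0 1) ∂γ := by
        refine lintegral_mono fun y => ?_
        rcases (Metric.closedBall 0 1 ∩ Φ ⁻¹' Metric.closedBall y δ).eq_empty_or_nonempty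
          with h0 | ⟨A, hA, hAy⟩
        · simp [h0]
        -- Two points of a slice have images within 2δ, so the slice lies in the ball of radius 2Kδ
        -- about any of its points.
        · rw [← Measure.addHaar_closedBall μ A (by positivity)]
          refine measure_mono fun B ⟨hB, hBy⟩ => ?_
          rw [mem_closedBall_zero_iff] at hA hB
          have hd : dist (Φ B) (Φ A) ≤ 2 * δ :=
            (dist_triangle_right _ _ y).trans (by
              linarith [Metric.mem_closedBall.mp hAy, Metric.mem_closedBall.mp hBy])
          rw [mem_closedBall_iff_norm]
          exact (hanti B A hB hA).trans (by gcongr)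
    _ = ENNReal.ofReal ((K * (2 * δ)) ^ Module.finrank ℝ E) * μ (Metric.ball 0 1) := by
        rw [lintegral_const, measure_univ, mul_one]

theorem le_measure_closedBall_of_lipschitz [SFinite γ] {δ K : ℝ} (hδ : 0 ≤ δ) (hK : 0 < K)
    (hδK : δ / K ≤ 1 / 2) (hγ : ∀ x y, γ (Metric.closedBall x δ) = γ (Metric.closedBall y δ))
    (hlip : ∀ A B, dist (Φ A) (Φ B) ≤ K * ‖A - B‖) {s : Set X} (hs : MeasurableSet s)
    (hsΦ : ∀ y ∈ s, ∃ A, ‖A‖ ≤ 1 / 2 ∧ Φ A = y) (x : X) :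
    γ s * ENNReal.ofReal ((δ / K) ^ Module.finrank ℝ E) ≤ γ (Metric.closedBall x δ) := by
  borelize E
  have : ProperSpace E := FiniteDimensional.proper ℝ E
  have hΦ : Continuous Φ := (LipschitzWith.of_dist_le_mul (K := ⟨K, hK.le⟩) fun A B => by
    rw [dist_eq_norm A B]
    exact hlip A B).continuous
  let μ : Measure E := Measure.addHaar
  have hM : μ (Metric.ball 0 1) ≠ 0 := (Metric.measure_ball_pos μ 0 one_pos).ne'
  have hM' : μ (Metric.ball 0 1) ≠ ⊤ := measure_ball_lt_top.ne
  rw [← ENNReal.mul_le_mul_iff_left hM hM', ← lintegral_measure_preimage_closedBall μ hΦ hγ]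
  calc γ s * ENNReal.ofReal ((δ / K) ^ Module.finrank ℝ E) * μ (Metric.ball 0 1)
      = ∫⁻ _ in s, ENNReal.ofReal ((δ / K) ^ Module.finrank ℝ E) * μ (Metric.ball 0 1) ∂γ := by
        rw [setLIntegral_const]
        ring
    _ ≤ ∫⁻ y in s, μ (Metric.closedBall 0 1 ∩ Φ ⁻¹' Metric.closedBall y δ) ∂γ := by
        refine setLIntegral_mono' hs fun y hy => ?_
        -- The slice over Φ A contains the ball of radius δ/K about A, which stays in the unit ball
        -- because ‖A‖ and δ/K are at most 1/2.
        obtain ⟨A, hA, rfl⟩ := hsΦ y hy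
        rw [← Measure.addHaar_closedBall μ A (by positivity)]
        refine measure_mono fun B hB => ?_
        rw [mem_closedBall_iff_norm] at hB
        refine ⟨mem_closedBall_zero_iff.mpr ?_, (hlip B A).trans ?_⟩
        · linarith [norm_le_norm_add_norm_sub' B A]
        · rwa [mul_comm, ← le_div_iff₀ hK]
    _ ≤ _ := setLIntegral_le_lintegral _ _

end UniformBalls

/-! ### The two bounds on the Grassmannian -/

namespace Grass

variable {n m : ℕ}

theorem gamma_closedBall_le (h : m ≤ n) (V : Grass n m) {δ : ℝ} (hδ : 0 ≤ δ) :
    gamma h (Metric.closedBall V δ) ≤ ENNReal.ofReal ((8 * δ) ^ (m * (n - m))) := by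
  have h₁ := measure_closedBall_le_of_antilipschitz (K := 4) V.continuous_graph hδ (by norm_num)
    (fun U W => gamma_closedBall_eq h U W δ) (fun A B hA hB =>
      (V.norm_sub_le_dist_graph A B).trans (by
        have h₂ : (1 + ‖A‖) * (1 + ‖B‖) ≤ (1 + 1) * (1 + 1) := by gcongr
        exact mul_le_mul_of_nonneg_right (by linarith) dist_nonneg)) V
  rwa [finrank_hom_orthogonal, ← mul_assoc, show (4 * 2 : ℝ) = 8 by norm_num] at h₁

theorem le_gamma_closedBall (h : m ≤ n) (V : Grass n m) {δ : ℝ} (hδ : 0 ≤ δ) (hδ' : δ ≤ 1) :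
    gamma h (Metric.closedBall V (1 / 3)) * ENNReal.ofReal ((δ / 2) ^ (m * (n - m))) ≤
      gamma h (Metric.closedBall V δ) := by
  rw [← V.finrank_hom_orthogonal]
  exact le_measure_closedBall_of_lipschitz (Φ := V.graph) hδ two_pos (by linarith)
    (fun U W => gamma_closedBall_eq h U W δ) V.dist_graph_le
    Metric.isClosed_closedBall.measurableSet
    (fun W hW => V.exists_graph_eq W (Metric.mem_closedBall'.mp hW)) V

end Grass

theorem propositionp (n m : ℕ) (hm : 0 < m) (hmn : m < n) :
    ∃ c C δ₀ : ℝ, 0 < c ∧ c < C ∧ 0 < δ₀ ∧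
      ∀ (V : Grass n m) (δ : ℝ), 0 < δ → δ < δ₀ →
        c * δ ^ (m * (n - m)) ≤ (Grass.gamma hmn.le).real (Metric.closedBall V δ) ∧
        (Grass.gamma hmn.le).real (Metric.closedBall V δ) ≤ C * δ ^ (m * (n - m)) := by
  set k := m * (n - m)
  set p := (Grass.gamma hmn.le).real (Metric.closedBall (Grass.base hmn.le) (1 / 3))
  have hp : 0 < p := ENNReal.toReal_pos
    (Grass.gamma_closedBall_pos hmn.le _ (by norm_num)).ne' (measure_ne_top _ _)
  -- Adding c to the upper constant 8^k makes c < C strict.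
  refine ⟨p / 2 ^ k, p / 2 ^ k + 8 ^ k, 1, by positivity, lt_add_of_pos_right _ (by positivity),
    one_pos, fun V δ hδ hδ' => ⟨?_, ?_⟩⟩
  · have h := ENNReal.toReal_mono (measure_ne_top _ _)
      (Grass.le_gamma_closedBall hmn.le V hδ.le hδ'.le)
    rw [ENNReal.toReal_mul, ENNReal.toReal_ofReal (by positivity),
      Grass.gamma_closedBall_eq hmn.le V (Grass.base hmn.le) (1 / 3)] at h
    calc p / 2 ^ k * δ ^ k = p * (δ / 2) ^ k := by rw [div_pow]; ring
      _ ≤ _ := h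
  · have h := ENNReal.toReal_mono ENNReal.ofReal_ne_top (Grass.gamma_closedBall_le hmn.le V hδ.le)
    rw [ENNReal.toReal_ofReal (by positivity), mul_pow] at h
    refine h.trans ?_
    gcongr
    exact le_add_of_nonneg_left (by positivity)
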